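/- Let $(M_n)_{n\ge1}$ and $(N_n)_{n\ge1}$ be sequences of integers with $M_n\ge 2$ and $1\le N_n\le M_n^2$ for all $n$ (no bound is imposed on the growth of $M_n$), and suppose that $$s=\liminf_{n\to\infty}\frac{\sum_{i=1}^n\log N_i}{\sum_{i=1}^n\log M_i}<1 .$$ Construct a random set $F\subset[0,1]^2$ as follows. Let $\mathcal F_0$ consist of the single square $[0,1]^2$. Given a finite list $\mathcal F_{n-1}$ of closed squares of side length $(M_1\cdots M_{n-1})^{-1}$, divide each square $Q$ of the list into its grid of $M_n^2$ closed subsquares of side length $(M_1\cdots M_n)^{-1}$, and choose $N_n$ of these subsquares uniformly at random and with replacement; all choices, inside the same square, inside different members of the list (even when these are copies of the same square) and at different steps, are independent. Let $\mathcal F_n$ be the list, with repetitions, of all the $N_1\cdots N_n$ chosen subsquares, and put $$F=\bigcap_{n=1}^\infty\ \bigcup_{Q\in\mathcal F_n}Q .$$ For a line $\ell\subset\mathbb R^2$ let $\pi_\ell$ denote the orthogonal projection onto $\ell$. Then, almost surely, $\dim_H\pi_\ell(F)=s$ for all lines $\ell\subset\mathbb R^2$ simultaneously, where $\dim_H$ denotes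 Hausdorff dimension. -/

import Mathlib

open MeasureTheory ProbabilityTheory Filter
open scoped ENNReal

noncomputable section

namespace RandomCantor

/-- The plane with its Euclidean metric. -/
abbrev Plane : Type := EuclideanSpace ℝ (Fin 2)

/-- The labels of the squares chosen at level `n`. The sequences are indexed from `0`, so `N i` is
the number of subsquares chosen in passing from level `i` to level `i + 1`, and
`w = (w 0, …, w (n - 1))` labels the `w (n - 1)`-th choice made inside the square labelled
`(w 0, …, w (n - 2))`. There are `N 0 * ⋯ * N (n - 1)` labels; different labels may carry the
same square. -/
abbrev Word (N : ℕ → ℕ) (n : ℕ) : Type := (i : Fin n) → Fin (N i)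

/-- All labels of level at least one: `⟨n, w⟩` stands for the choice, inside the level `n` square
labelled `Fin.init w`, of the level `n + 1` square labelled `w`. -/
abbrev Node (N : ℕ → ℕ) : Type := Σ n : ℕ, Word N (n + 1)

/-- A realization of all the choices: the choice `⟨n, w⟩` is a cell of the `M n × M n` grid,
given by its column and its row. -/
abbrev Choices (M N : ℕ → ℕ) : Type := (v : Node N) → Fin 2 → Fin (M v.1)

/-- The side length `(M 0 * ⋯ * M (n - 1))⁻¹` of the squares of level `n`. -/
def sideLength (M : ℕ → ℕ) (n : ℕ) : ℝ := (∏ k ∈ Finset.range n, (M k : ℝ))⁻¹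

/-- The lower left corner of the level `n` square labelled `w`. The square of level `0` is
`[0,1]²`, and the level `n + 1` square labelled `w` is the chosen cell of the `M n`-adic grid of the
level `n` square labelled `Fin.init w`. -/
def corner {M N : ℕ → ℕ} (c : Choices M N) : (n : ℕ) → Word N n → Fin 2 → ℝ
  | 0, _ => fun _ => 0
  | n + 1, w => fun i =>
      corner c n (Fin.init w) i + sideLength M (n + 1) * ((c ⟨n, w⟩ i : ℕ) : ℝ)

/-- The closed level `n` square labelled `w`. -/
def square {M N : ℕ → ℕ} (c : Choices M N) (n : ℕ) (w : Word N n) : Set Plane :=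
  {x | ∀ i, x i ∈ Set.Icc (corner c n w i) (corner c n w i + sideLength M n)}

/-- The limit set: the intersection over all levels of the union of the chosen squares
(level `0` contributes `[0,1]²`, which contains all the others). -/
def limitSet {M N : ℕ → ℕ} (c : Choices M N) : Set Plane :=
  ⋂ n : ℕ, ⋃ w : Word N n, square c n w

end RandomCantor

end

noncomputable section

namespace RandomCantor

/-! The upper bound holds for every realization: $F$ is covered by $N_1\cdots N_n$ squares of side
$(M_1\cdots M_n)^{-1}$, these covers are efficient for infinitely many $n$, and projections are
1-Lipschitz (`dimH_limitSet_le`).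

For the lower bound let $0<t<t'<s<1$. Distribute mass uniformly over the infinite branches and
project it. By the mass distribution principle it suffices that, for all large $k$, every strip of
width about $2^{-k}$, in every direction, has mass $O(2^{-tk})$. A net of $O(4^k)$ strips represents
them all, so it is enough that a single strip fails with probability far below $4^{-k}$.

The mass of a strip is controlled by the mean, over labels of level $k$, of the proportion of the
square lying in a slightly wider strip; $k$ levels suffice because $M_n\ge2$. As the level grows,
these means form a martingale started at $O(2^{-k})$. With $R_j=M_1\cdots M_j$, one label of level
$j$ contributes at most a constant times $\min(1,2^{-k}R_j)/(N_1\cdots N_j)$. Since $t'\le1$ the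
numerator is $O((2^{-k}R_j)^{t'})$, and the denominator is at least $cR_j^{t'}$, so every
contribution is $O(2^{-kt'})$, however fast $M_n$ grows. Given the past the contributions are
independent, so an exponential moment with parameter of order $2^{kt'}/k$ loses only a factor
$1+1/k$ in the exponent per level (`lintegral_exp_wordMean_le`). Chernoff's inequality bounds the
failure probability by $\exp(-c'2^{(t'-t)k}/k)$ (`measure_wordMean_bandDensity_le`), and
Borel–Cantelli concludes. -/

/-! ### Exponential moments of means over labels. -/

/-- If, for independent discrete variables, the conditional expectation of a product over `T`
given the variables in `S` is bounded by `H`, then so is the integral. -/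
theorem lintegral_prod_le_of_iIndepFun {Ω ι : Type*} [MeasurableSpace Ω] {P : Measure Ω}
    [IsProbabilityMeasure P] {β : ι → Type*} [∀ i, MeasurableSpace (β i)] [∀ i, Countable (β i)]
    [∀ i, MeasurableSingletonClass (β i)] {X : (i : ι) → Ω → β i} (hX : ∀ i, Measurable (X i))
    (hindep : iIndepFun X P) {S T : Finset ι} (hST : Disjoint S T)
    (h : ((i : S) → β i) → (i : ι) → β i → ℝ≥0∞) (H : ((i : S) → β i) → ℝ≥0∞)
    (hH : ∀ a, ∏ i ∈ T, ∫⁻ ω, h a i (X i ω) ∂P ≤ H a) :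
    ∫⁻ ω, ∏ i ∈ T, h (fun j => X j ω) i (X i ω) ∂P ≤ ∫⁻ ω, H (fun j => X j ω) ∂P := by
  have hA : Measurable (fun ω (j : S) => X j ω) := measurable_pi_lambda _ fun j => hX j
  have hB : Measurable (fun ω (j : T) => X j ω) := measurable_pi_lambda _ fun j => hX j
  have hmap := (indepFun_iff_map_prod_eq_prod_map_map hA.aemeasurable hB.aemeasurable).1
    (hindep.indepFun_finset S T hST hX)
  have := Measure.isProbabilityMeasure_map (μ := P) hA.aemeasurable
  have := Measure.isProbabilityMeasure_map (μ := P) hB.aemeasurable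
  obtain ⟨F, hF⟩ : ∃ F : ((i : S) → β i) × ((i : T) → β i) → ℝ≥0∞,
      ∀ p, F p = ∏ i : T, h p.1 i (p.2 i) := ⟨_, fun _ => rfl⟩
  have e : ∀ ω, ∏ i ∈ T, h (fun j => X j ω) i (X i ω) =
      F ((fun j => X j ω), (fun j => X j ω)) := fun ω => by
    rw [hF]
    exact (Finset.prod_coe_sort T (fun i => h (fun j => X j ω) i (X i ω))).symm
  rw [lintegral_congr e,
    ← lintegral_map (f := F) Measurable.of_discrete (hA.prodMk hB), hmap,
    lintegral_prod _ Measurable.of_discrete.aemeasurable,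
    ← lintegral_map (μ := P) (g := fun ω (j : S) => X j ω) Measurable.of_discrete hA]
  simp only [hF]
  refine lintegral_mono fun a => ?_
  rw [lintegral_map Measurable.of_discrete hB]
  refine le_trans (le_of_eq ?_) (hH a)
  rw [← Finset.prod_coe_sort T (fun i => ∫⁻ ω, h a i (X i ω) ∂P)]
  have hind : iIndepFun (fun (i : T) ω => h a i (X i ω)) P :=
    (hindep.precomp Subtype.val_injective).comp (fun i : T => h a i)
      fun i => Measurable.of_discrete
  exact lintegral_prod_eq_prod_lintegral_of_indepFun Finset.univ _ hind
    fun i => Measurable.of_discrete.comp (hX i)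

theorem exp_le_one_add_mul {x κ : ℝ} (h0 : 0 ≤ x) (hx : x ≤ κ) (hκ : κ ≤ 1) :
    Real.exp x ≤ 1 + (1 + κ) * x := by
  have h := Real.abs_exp_sub_one_sub_id_le (x := x) (by rw [abs_of_nonneg h0]; linarith)
  have := (abs_le.1 h).2
  nlinarith

/-- Linearizing the exponential on $[0,\kappa]$ costs a factor $1+\kappa$ in the exponent and turns
a mean of exponentials into an exponential of the mean. -/
theorem lintegral_exp_le_of_uniform {Ω α : Type*} [MeasurableSpace Ω] {P : Measure Ω}
    [Fintype α] [MeasurableSpace α] [MeasurableSingletonClass α] {Y : Ω → α}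
    (hY : Measurable Y) {m : ℕ} (hm : 0 < m) (hcard : Fintype.card α = m)
    (hunif : ∀ q, P {ω | Y ω = q} = (m : ℝ≥0∞)⁻¹) {g : α → ℝ} {κ a θ : ℝ} (hg : ∀ q, 0 ≤ g q)
    (hθ : 0 ≤ θ) (hgκ : ∀ q, θ * g q ≤ κ) (hκ : κ ≤ 1) (ha : ∑ q, g q ≤ m * a) :
    ∫⁻ ω, ENNReal.ofReal (Real.exp (θ * g (Y ω))) ∂P ≤
      ENNReal.ofReal (Real.exp (θ * (1 + κ) * a)) := by
  have hm' : (0 : ℝ) < m := by exact_mod_cast hm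
  rw [← lintegral_map (f := fun q => ENNReal.ofReal (Real.exp (θ * g q))) Measurable.of_discrete hY,
    lintegral_fintype]
  have e : ∀ q, Measure.map Y P {q} = ENNReal.ofReal ((m : ℝ)⁻¹) := fun q => by
    rw [Measure.map_apply hY (measurableSet_singleton q), ENNReal.ofReal_inv_of_pos hm',
      ENNReal.ofReal_natCast, ← hunif q]
    rfl
  simp_rw [e]
  rw [← Finset.sum_mul, ← ENNReal.ofReal_sum_of_nonneg fun q _ => (Real.exp_pos _).le,
    ← ENNReal.ofReal_mul (Finset.sum_nonneg fun q _ => (Real.exp_pos _).le)]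
  refine ENNReal.ofReal_le_ofReal ?_
  have hκ0 : 0 ≤ κ := by
    obtain ⟨q⟩ : Nonempty α := Fintype.card_pos_iff.1 (hcard ▸ hm)
    exact (mul_nonneg hθ (hg q)).trans (hgκ q)
  calc (∑ q, Real.exp (θ * g q)) * (m : ℝ)⁻¹
      ≤ (∑ q, (1 + (1 + κ) * (θ * g q))) * (m : ℝ)⁻¹ := by
        gcongr with q
        exact exp_le_one_add_mul (mul_nonneg hθ (hg q)) (hgκ q) hκ
    _ = (m + (1 + κ) * θ * ∑ q, g q) * (m : ℝ)⁻¹ := by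
        rw [Finset.sum_add_distrib, ← Finset.mul_sum, ← Finset.mul_sum]
        simp [hcard, mul_assoc]
    _ ≤ (m + (1 + κ) * θ * (m * a)) * (m : ℝ)⁻¹ := by gcongr
    _ = θ * (1 + κ) * a + 1 := by field_simp; ring
    _ ≤ _ := Real.add_one_le_exp _

/-- The labels of all choices made before level `m`. -/
def pastNodes (N : ℕ → ℕ) (m : ℕ) : Finset (Node N) :=
  (Finset.range m).sigma fun _ => Finset.univ

/-- The labels of the choices leading from level `m` to level `m + 1`. -/
def presentNodes (N : ℕ → ℕ) (m : ℕ) : Finset (Node N) :=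
  ({m} : Finset ℕ).sigma fun _ => Finset.univ

theorem disjoint_pastNodes_presentNodes (N : ℕ → ℕ) (m : ℕ) :
    Disjoint (pastNodes N m) (presentNodes N m) := by
  rw [Finset.disjoint_left]
  rintro ⟨k, w⟩ h1 h2
  simp only [pastNodes, presentNodes, Finset.mem_sigma, Finset.mem_range,
    Finset.mem_singleton] at h1 h2
  omega

theorem corner_congr {M N : ℕ → ℕ} {c c' : Choices M N} {m : ℕ}
    (h : ∀ v ∈ pastNodes N m, c v = c' v) (w : Word N m) : corner c m w = corner c' m w := by
  induction m with
  | zero => rfl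
  | succ m ih =>
    funext i
    have h1 := h ⟨m, w⟩ (by simp [pastNodes])
    have h2 := ih (fun v hv => h v (by
      simp only [pastNodes, Finset.mem_sigma, Finset.mem_range] at hv ⊢
      exact ⟨by omega, hv.2⟩)) (Fin.init w)
    simp only [corner]
    rw [h1, h2]

theorem sum_word_succ (N : ℕ → ℕ) (m : ℕ) (f : Word N m → ℝ) :
    ∑ w : Word N (m + 1), f (Fin.init w) = N m * ∑ w, f w := by
  rw [← (Fin.snocEquiv fun i : Fin (m + 1) => Fin (N i)).sum_comp, Fintype.sum_prod_type]
  simp [Fin.snocEquiv, Fin.init_snoc]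

/-- The mean over all labels of level `n` of a function of the square with this label. -/
def wordMean {M N : ℕ → ℕ} (c : Choices M N) (n : ℕ) (f : (Fin 2 → ℝ) → ℝ) : ℝ :=
  (∏ i ∈ Finset.range n, (N i : ℝ))⁻¹ * ∑ w : Word N n, f (corner c n w)

section ExpMoment

variable {M N : ℕ → ℕ} {Ω : Type*} [MeasurableSpace Ω] {P : Measure Ω} [IsProbabilityMeasure P]
  {X : (v : Node N) → Ω → Fin 2 → Fin (M v.1)}

/-- Given the past, the summands of level `m + 1` are independent, each driven by one uniform
choice, so the moment factors. The mean of `g` over subsquares is at most `f`, and each label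
contributes at most `κ` to the exponent. -/
theorem lintegral_exp_wordMean_succ_le (hM : ∀ n, 0 < M n) (hN : ∀ n, 0 < N n)
    (hX : ∀ v, Measurable (X v))
    (hunif : ∀ v q, P {ω | X v ω = q} = ((M v.1 : ℝ≥0∞) ^ 2)⁻¹)
    (hindep : iIndepFun X P) {m : ℕ} {f g : (Fin 2 → ℝ) → ℝ} (hg : ∀ x, 0 ≤ g x)
    (hfg : ∀ x : Fin 2 → ℝ, ∑ q : Fin 2 → Fin (M m),
      g (fun i => x i + sideLength M (m + 1) * ((q i : ℕ) : ℝ)) ≤ (M m : ℝ) ^ 2 * f x)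
    {t κ : ℝ} (ht : 0 ≤ t) (hκ : κ ≤ 1)
    (htκ : ∀ x, t * g x ≤ κ * ∏ i ∈ Finset.range (m + 1), (N i : ℝ)) :
    ∫⁻ ω, ENNReal.ofReal (Real.exp (t * wordMean (fun v => X v ω) (m + 1) g)) ∂P ≤
      ∫⁻ ω, ENNReal.ofReal (Real.exp (t * (1 + κ) * wordMean (fun v => X v ω) m f)) ∂P := by
  classical
  set p : ℝ := ∏ i ∈ Finset.range (m + 1), (N i : ℝ) with hp
  have hp0 : 0 < p := Finset.prod_pos fun i _ => by exact_mod_cast hN i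
  set S := pastNodes N m
  -- The default cell outside `S` is immaterial: corners of level `m` depend only on earlier
  -- choices.
  let extend (a : (v : S) → Fin 2 → Fin (M v.1.1)) : Choices M N := fun v =>
    if hv : v ∈ S then a ⟨v, hv⟩ else fun _ => ⟨0, hM v.1⟩
  have hcorner : ∀ ω w, corner (extend fun v => X v ω) m w = corner (fun v => X v ω) m w :=
    fun ω w => corner_congr (c' := fun v => X v ω) (fun v hv => dif_pos hv) w
  let h (a : (v : S) → Fin 2 → Fin (M v.1.1)) (v : Node N) (q : Fin 2 → Fin (M v.1)) : ℝ≥0∞ :=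
    ENNReal.ofReal (Real.exp (t / p * g fun i =>
      corner (extend a) v.1 (Fin.init v.2) i + sideLength M (v.1 + 1) * ((q i : ℕ) : ℝ)))
  have key := lintegral_prod_le_of_iIndepFun hX hindep (disjoint_pastNodes_presentNodes N m) h
    (fun a => ENNReal.ofReal (Real.exp (t * (1 + κ) * wordMean (extend a) m f))) (fun a => by
      simp only [presentNodes, Finset.prod_sigma, Finset.prod_singleton]
      calc _ ≤ ∏ w : Word N (m + 1), ENNReal.ofReal
            (Real.exp (t / p * (1 + κ) * f (corner (extend a) m (Fin.init w)))) := by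
            refine Finset.prod_le_prod' fun w _ => ?_
            refine lintegral_exp_le_of_uniform (hX ⟨m, w⟩) (m := M m ^ 2)
              (g := fun q => g fun i => corner (extend a) m (Fin.init w) i +
                sideLength M (m + 1) * ((q i : ℕ) : ℝ)) (pow_pos (hM m) 2) (by simp)
              (fun q => by rw [hunif]; push_cast; rfl) (fun q => hg _) (by positivity)
              (fun q => ?_) hκ (by push_cast; exact hfg _)
            rw [div_mul_eq_mul_div, div_le_iff₀ hp0]
            exact htκ _
        _ = _ := by
            rw [← ENNReal.ofReal_prod_of_nonneg fun _ _ => (Real.exp_pos _).le, ← Real.exp_sum,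
              ← Finset.mul_sum,
              sum_word_succ N m fun w => f (corner (extend a) m w)]
            congr 2
            have : (N m : ℝ) ≠ 0 := by exact_mod_cast (hN m).ne'
            have : (∏ i ∈ Finset.range m, (N i : ℝ)) ≠ 0 :=
              Finset.prod_ne_zero_iff.2 fun i _ => by exact_mod_cast (hN i).ne'
            rw [wordMean, hp, Finset.prod_range_succ]
            field_simp)
  refine le_trans (le_of_eq ?_) (key.trans (le_of_eq ?_))
  · refine lintegral_congr fun ω => ?_
    simp only [presentNodes, Finset.prod_sigma, Finset.prod_singleton, h]
    rw [← ENNReal.ofReal_prod_of_nonneg fun _ _ => (Real.exp_pos _).le, ← Real.exp_sum,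
      ← Finset.mul_sum, wordMean, ← mul_assoc, ← div_eq_mul_inv]
    refine congrArg (fun z => ENNReal.ofReal (Real.exp (t / p * z)))
      (Finset.sum_congr rfl fun w _ => congrArg g (funext fun i => ?_))
    rw [hcorner ω (Fin.init w)]
    rfl
  · refine lintegral_congr fun ω =>
      congrArg (fun z => ENNReal.ofReal (Real.exp (t * (1 + κ) * (_ * z))))
        (Finset.sum_congr rfl fun w _ => congrArg f (hcorner ω w))

theorem lintegral_exp_wordMean_le (hM : ∀ n, 0 < M n) (hN : ∀ n, 0 < N n)
    (hX : ∀ v, Measurable (X v))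
    (hunif : ∀ v q, P {ω | X v ω = q} = ((M v.1 : ℝ≥0∞) ^ 2)⁻¹)
    (hindep : iIndepFun X P) {n : ℕ} (hn : 0 < n) {G : ℕ → (Fin 2 → ℝ) → ℝ}
    (hG : ∀ m x, 0 ≤ G m x)
    (hGsum : ∀ m, ∀ x : Fin 2 → ℝ, ∑ q : Fin 2 → Fin (M m),
      G (m + 1) (fun i => x i + sideLength M (m + 1) * ((q i : ℕ) : ℝ)) ≤ (M m : ℝ) ^ 2 * G m x)
    {t : ℝ} (ht : 0 ≤ t)
    (htG : ∀ m < n, ∀ x, 3 * n * t * G (m + 1) x ≤ ∏ i ∈ Finset.range (m + 1), (N i : ℝ)) :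
    ∫⁻ ω, ENNReal.ofReal (Real.exp (t * wordMean (fun v => X v ω) n (G n))) ∂P ≤
      ENNReal.ofReal (Real.exp (3 * t * G 0 0)) := by
  have hn' : (0 : ℝ) < n := by exact_mod_cast hn
  -- Each step is run with `κ = 1 / n`; the accumulated factor stays below $e\le3$, which is the 3
  -- in `htG` and in the conclusion.
  have hpow : ∀ j ≤ n, (1 + 1 / (n : ℝ)) ^ j ≤ 3 := fun j hj => by
    calc (1 + 1 / (n : ℝ)) ^ j ≤ (1 + 1 / (n : ℝ)) ^ n :=
          pow_le_pow_right₀ (by simp) hj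
      _ ≤ Real.exp (1 / n) ^ n := by
          gcongr
          rw [add_comm]
          exact Real.add_one_le_exp _
      _ = Real.exp 1 := by rw [← Real.exp_nat_mul]; congr 1; field_simp
      _ ≤ 3 := (Real.exp_one_lt_d9.trans (by norm_num)).le
  have main : ∀ j ≤ n,
      ∫⁻ ω, ENNReal.ofReal (Real.exp (t * wordMean (fun v => X v ω) n (G n))) ∂P ≤
        ∫⁻ ω, ENNReal.ofReal (Real.exp
          (t * (1 + 1 / (n : ℝ)) ^ j * wordMean (fun v => X v ω) (n - j) (G (n - j)))) ∂P := by
    intro j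
    induction j with
    | zero => simp
    | succ j ih =>
      intro hj
      refine (ih (by omega)).trans ?_
      obtain ⟨m, hm⟩ : ∃ m, n - j = m + 1 := ⟨n - j - 1, by omega⟩
      have hm' : n - (j + 1) = m := by omega
      rw [hm, hm', pow_succ, ← mul_assoc]
      refine lintegral_exp_wordMean_succ_le hM hN hX hunif hindep (hG _) (hGsum m)
        (by positivity) ?_ fun x => ?_
      · rw [div_le_one hn']; exact_mod_cast hn
      · rw [div_mul_eq_mul_div, one_mul, le_div_iff₀ hn']
        refine le_trans ?_ (htG m (by omega) x)
        have := mul_le_mul_of_nonneg_right (hpow j (by omega))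
          (mul_nonneg (mul_nonneg ht hn'.le) (hG (m + 1) x))
        linarith
  refine (main n le_rfl).trans ?_
  rw [Nat.sub_self]
  have e : ∀ ω, wordMean (fun v => X v ω) 0 (G 0) = G 0 0 := fun ω => by
    rw [wordMean]
    simp only [Finset.range_zero, Finset.prod_empty, inv_one, one_mul, Finset.univ_unique,
      Finset.sum_singleton]
    rfl
  simp only [e, lintegral_const, measure_univ, mul_one]
  refine ENNReal.ofReal_le_ofReal (Real.exp_le_exp.2 ?_)
  have := mul_le_mul_of_nonneg_right (hpow n le_rfl) (mul_nonneg ht (hG 0 0))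
  linarith

end ExpMoment

/-! ### Areas of bands inside squares. -/

/-- The band of points at horizontal distance at most `w` from the line `x = m * y + a`. -/
def band (m a w : ℝ) : Set (ℝ × ℝ) := {z | |z.1 - m * z.2 - a| ≤ w}

/-- A half-open square. -/
def cell (x y l : ℝ) : Set (ℝ × ℝ) := Set.Ico x (x + l) ×ˢ Set.Ico y (y + l)

/-- The proportion of the square with corner `x` and side `l` lying in a band, where the
coordinate `p` plays the role of the horizontal coordinate. -/
def bandDensity (p : Fin 2) (m a w l : ℝ) (x : Fin 2 → ℝ) : ℝ :=
  volume.real (band m a w ∩ cell (x p) (x (1 - p)) l) / l ^ 2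

theorem measurableSet_band (m a w : ℝ) : MeasurableSet (band m a w) :=
  (isClosed_le (by fun_prop) continuous_const).measurableSet

theorem measurableSet_cell (x y l : ℝ) : MeasurableSet (cell x y l) :=
  measurableSet_Ico.prod measurableSet_Ico

theorem volume_cell {l : ℝ} (x y : ℝ) : volume (cell x y l) = ENNReal.ofReal l * ENNReal.ofReal l := by
  rw [cell, Measure.volume_eq_prod, Measure.prod_prod, Real.volume_Ico, Real.volume_Ico]
  simp

theorem volume_cell_ne_top (x y l : ℝ) : volume (cell x y l) ≠ ⊤ := by
  rw [volume_cell]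
  exact ENNReal.mul_ne_top ENNReal.ofReal_ne_top ENNReal.ofReal_ne_top

theorem volumeReal_cell {l : ℝ} (hl : 0 ≤ l) (x y : ℝ) : volume.real (cell x y l) = l ^ 2 := by
  rw [measureReal_def, volume_cell, ENNReal.toReal_mul, ENNReal.toReal_ofReal hl, sq]

theorem bandDensity_nonneg (p : Fin 2) (m a w l : ℝ) (x : Fin 2 → ℝ) :
    0 ≤ bandDensity p m a w l x :=
  div_nonneg measureReal_nonneg (sq_nonneg _)

theorem bandDensity_le_one (p : Fin 2) (m a w : ℝ) {l : ℝ} (hl : 0 < l) (x : Fin 2 → ℝ) :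
    bandDensity p m a w l x ≤ 1 := by
  rw [bandDensity, div_le_one (by positivity), ← volumeReal_cell hl.le (x p) (x (1 - p))]
  exact measureReal_mono Set.inter_subset_right (volume_cell_ne_top _ _ _)

theorem bandDensity_eq_one (p : Fin 2) {m a w l : ℝ} (hl : 0 < l) {x : Fin 2 → ℝ}
    (h : cell (x p) (x (1 - p)) l ⊆ band m a w) : bandDensity p m a w l x = 1 := by
  rw [bandDensity, Set.inter_eq_right.2 h, volumeReal_cell hl.le, div_self (by positivity)]

/-- Fubini: each slice of the band at fixed second coordinate has length `2 * w`. -/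
theorem bandDensity_le (p : Fin 2) (m a : ℝ) {w l : ℝ} (hw : 0 ≤ w) (hl : 0 < l) (x : Fin 2 → ℝ) :
    bandDensity p m a w l x ≤ 2 * w / l := by
  have h : volume (band m a w ∩ cell (x p) (x (1 - p)) l) ≤ ENNReal.ofReal (2 * w * l) := by
    rw [Measure.volume_eq_prod,
      Measure.prod_apply_symm ((measurableSet_band m a w).inter (measurableSet_cell _ _ _))]
    calc _ ≤ ∫⁻ y, (Set.Ico (x (1 - p)) (x (1 - p) + l)).indicator
          (fun _ => ENNReal.ofReal (2 * w)) y := by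
          refine lintegral_mono fun y => ?_
          by_cases hy : y ∈ Set.Ico (x (1 - p)) (x (1 - p) + l)
          · rw [Set.indicator_of_mem hy]
            refine (measure_mono (t := Set.Icc (m * y + a - w) (m * y + a + w)) ?_).trans ?_
            · intro z hz
              have := abs_le.1 (show |z - m * y - a| ≤ w from hz.1)
              constructor <;> linarith
            · rw [Real.volume_Icc]
              exact ENNReal.ofReal_le_ofReal (by linarith)
          · rw [Set.indicator_of_notMem hy]
            refine (measure_mono_null (t := ∅) ?_ measure_empty).le
            intro z hz
            exact hy hz.2.2
      _ = ENNReal.ofReal (2 * w) * ENNReal.ofReal l := by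
          rw [lintegral_indicator measurableSet_Ico, setLIntegral_const, Real.volume_Ico]
          simp
      _ = _ := (ENNReal.ofReal_mul (by positivity)).symm
  rw [bandDensity, div_le_div_iff₀ (by positivity) hl]
  have h2 := ENNReal.toReal_le_of_le_ofReal (by positivity) h
  rw [← measureReal_def] at h2
  nlinarith

theorem Ico_grid_disjoint {x d : ℝ} (hd : 0 < d) {i j : ℕ} {z : ℝ}
    (hi : z ∈ Set.Ico (x + d * i) (x + d * i + d)) (hj : z ∈ Set.Ico (x + d * j) (x + d * j + d)) :
    i = j := by
  have key : ∀ i j : ℕ, z ∈ Set.Ico (x + d * i) (x + d * i + d) →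
      z ∈ Set.Ico (x + d * j) (x + d * j + d) → i ≤ j := by
    intro i j hi hj
    by_contra! h
    have : (j : ℝ) + 1 ≤ i := by exact_mod_cast h
    have h1 := hi.1
    have h2 := hj.2
    nlinarith
  exact le_antisymm (key i j hi hj) (key j i hj hi)

theorem Ico_grid_subset {x l : ℝ} (hl : 0 < l) {k : ℕ} (i : Fin k) :
    Set.Ico (x + l / k * (i : ℕ)) (x + l / k * (i : ℕ) + l / k) ⊆ Set.Ico x (x + l) := by
  have hk : (0 : ℝ) < k := by exact_mod_cast i.pos
  have hi : ((i : ℕ) : ℝ) + 1 ≤ k := by exact_mod_cast i.2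
  have h0 : 0 ≤ l / k * (i : ℕ) := by positivity
  have h1 : l / k * (i : ℕ) + l / k ≤ l := by
    rw [← mul_add_one, div_mul_eq_mul_div, div_le_iff₀ hk]
    gcongr
  exact Set.Ico_subset_Ico (by linarith) (by linarith)

/-- Half-open subcells are disjoint, so areas add. This supplies the supermartingale inequality for
the means of band densities. -/
theorem sum_bandDensity_le (p : Fin 2) (m a w : ℝ) {l : ℝ} (hl : 0 < l) {k : ℕ} (hk : 0 < k)
    (x : Fin 2 → ℝ) :
    ∑ q : Fin 2 → Fin k, bandDensity p m a w (l / k) (fun i => x i + l / k * ((q i : ℕ) : ℝ)) ≤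
      (k : ℝ) ^ 2 * bandDensity p m a w l x := by
  have hk' : (0 : ℝ) < k := by exact_mod_cast hk
  simp only [bandDensity]
  rw [← Finset.sum_div, div_le_iff₀ (by positivity), ← measureReal_biUnion_finset ?_ ?_ ?_]
  · have : (k : ℝ) ^ 2 * (volume.real (band m a w ∩ cell (x p) (x (1 - p)) l) / l ^ 2) *
        (l / k) ^ 2 = volume.real (band m a w ∩ cell (x p) (x (1 - p)) l) := by
      field_simp
    rw [this]
    refine measureReal_mono (Set.iUnion₂_subset fun q _ => ?_)
      (measure_ne_top_of_subset Set.inter_subset_right (volume_cell_ne_top _ _ _))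
    exact Set.inter_subset_inter_right _
      (Set.prod_mono (Ico_grid_subset hl _) (Ico_grid_subset hl _))
  · intro q _ q' _ hqq
    refine Set.disjoint_left.2 fun z hz hz' => hqq ?_
    have h1 : q p = q' p := Fin.ext (Ico_grid_disjoint (by positivity) hz.2.1 hz'.2.1)
    have h2 : q (1 - p) = q' (1 - p) := Fin.ext (Ico_grid_disjoint (by positivity) hz.2.2 hz'.2.2)
    funext i
    fin_cases p <;> fin_cases i <;> simp_all
  · exact fun q _ => (measurableSet_band m a w).inter (measurableSet_cell _ _ _)
  · exact fun q _ => measure_ne_top_of_subset Set.inter_subset_right (volume_cell_ne_top _ _ _)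

/-! ### Scales, Chernoff's inequality and measurability. -/

theorem sideLength_pos {M : ℕ → ℕ} (hM : ∀ n, 0 < M n) (n : ℕ) : 0 < sideLength M n :=
  inv_pos.2 (Finset.prod_pos fun i _ => by exact_mod_cast hM i)

theorem sideLength_succ (M : ℕ → ℕ) (n : ℕ) : sideLength M (n + 1) = sideLength M n / M n := by
  rw [sideLength, sideLength, Finset.prod_range_succ, mul_inv, div_eq_mul_inv]

theorem sideLength_zero (M : ℕ → ℕ) : sideLength M 0 = 1 := by simp [sideLength]

theorem two_pow_le_prod {M : ℕ → ℕ} (hM : ∀ n, 2 ≤ M n) (k : ℕ) :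
    (2 : ℝ) ^ k ≤ ∏ i ∈ Finset.range k, (M i : ℝ) := by
  rw [← Finset.card_range k, ← Finset.prod_const, Finset.card_range]
  exact Finset.prod_le_prod (fun _ _ => by norm_num) fun i _ => by exact_mod_cast hM i

theorem two_rpow_neg_pow (t : ℝ) (k : ℕ) : ((2 : ℝ) ^ (-t)) ^ k = (((2 : ℝ) ^ k)⁻¹) ^ t := by
  rw [Real.inv_rpow (by positivity), ← Real.rpow_natCast, ← Real.rpow_natCast,
    ← Real.rpow_mul (by norm_num), ← Real.rpow_mul (by norm_num), ← Real.rpow_neg (by norm_num)]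
  congr 1
  ring

theorem measure_le_of_lintegral_exp_le {Ω : Type*} [MeasurableSpace Ω] {P : Measure Ω}
    {Z : Ω → ℝ} (hZ : Measurable Z) {u x y : ℝ} (hu : 0 ≤ u)
    (h : ∫⁻ ω, ENNReal.ofReal (Real.exp (u * Z ω)) ∂P ≤ ENNReal.ofReal (Real.exp y)) :
    P {ω | x ≤ Z ω} ≤ ENNReal.ofReal (Real.exp (y - u * x)) := by
  have h1 := mul_meas_ge_le_lintegral (μ := P)
    (f := fun ω => ENNReal.ofReal (Real.exp (u * Z ω))) (by fun_prop)
    (ENNReal.ofReal (Real.exp (u * x)))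
  have h2 : P {ω | x ≤ Z ω} ≤ P {ω | ENNReal.ofReal (Real.exp (u * x)) ≤
      ENNReal.ofReal (Real.exp (u * Z ω))} := by
    refine measure_mono fun ω hω => ?_
    exact ENNReal.ofReal_le_ofReal (Real.exp_le_exp.2 (mul_le_mul_of_nonneg_left hω hu))
  rw [Real.exp_sub, ENNReal.ofReal_div_of_pos (Real.exp_pos _), ENNReal.le_div_iff_mul_le
    (Or.inl (by simpa using Real.exp_pos _)) (Or.inl ENNReal.ofReal_ne_top), mul_comm]
  exact (mul_le_mul_right h2 _).trans (h1.trans h)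

theorem measurable_corner {M N : ℕ → ℕ} {Ω : Type*} [MeasurableSpace Ω]
    {X : (v : Node N) → Ω → Fin 2 → Fin (M v.1)} (hX : ∀ v, Measurable (X v)) (n : ℕ)
    (w : Word N n) : Measurable fun ω => corner (fun v => X v ω) n w := by
  induction n with
  | zero => exact measurable_const
  | succ n ih =>
    refine measurable_pi_lambda _ fun i => ?_
    have h1 : Measurable fun ω => corner (fun v => X v ω) n (Fin.init w) i :=
      (measurable_pi_apply i).comp (ih (Fin.init w))
    have h2 : Measurable fun ω => ((X ⟨n, w⟩ ω i : ℕ) : ℝ) :=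
      (Measurable.of_discrete (f := fun q : Fin 2 → Fin (M n) => ((q i : ℕ) : ℝ))).comp
        (hX ⟨n, w⟩)
    exact h1.add (h2.const_mul _)

theorem measurable_bandDensity (p : Fin 2) (m a w l : ℝ) :
    Measurable (bandDensity p m a w l) := by
  have h : MeasurableSet {z : (Fin 2 → ℝ) × (ℝ × ℝ) |
      z.2 ∈ band m a w ∩ cell (z.1 p) (z.1 (1 - p)) l} := by
    have e : {z : (Fin 2 → ℝ) × (ℝ × ℝ) | z.2 ∈ band m a w ∩ cell (z.1 p) (z.1 (1 - p)) l} =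
        (Prod.snd ⁻¹' band m a w) ∩ (({z : (Fin 2 → ℝ) × (ℝ × ℝ) | z.1 p ≤ z.2.1} ∩
          {z : (Fin 2 → ℝ) × (ℝ × ℝ) | z.2.1 < z.1 p + l}) ∩
          ({z : (Fin 2 → ℝ) × (ℝ × ℝ) | z.1 (1 - p) ≤ z.2.2} ∩
          {z : (Fin 2 → ℝ) × (ℝ × ℝ) | z.2.2 < z.1 (1 - p) + l})) := rfl
    rw [e]
    refine (measurable_snd (measurableSet_band m a w)).inter (.inter (.inter ?_ ?_) (.inter ?_ ?_))
    · exact measurableSet_le (by fun_prop) (by fun_prop)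
    · exact measurableSet_lt (by fun_prop) (by fun_prop)
    · exact measurableSet_le (by fun_prop) (by fun_prop)
    · exact measurableSet_lt (by fun_prop) (by fun_prop)
  exact ((measurable_measure_prodMk_left h).ennreal_toReal).div_const _

theorem measurable_wordMean {M N : ℕ → ℕ} {Ω : Type*} [MeasurableSpace Ω]
    {X : (v : Node N) → Ω → Fin 2 → Fin (M v.1)} (hX : ∀ v, Measurable (X v)) (n : ℕ)
    {f : (Fin 2 → ℝ) → ℝ} (hf : Measurable f) :
    Measurable fun ω => wordMean (fun v => X v ω) n f :=
  (Finset.measurable_sum _ fun w _ => hf.comp (measurable_corner hX n w)).const_mul _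

/-! ### Tail bounds and Borel–Cantelli for the net of bands. -/

section Tail

variable {M N : ℕ → ℕ} {Ω : Type*} [MeasurableSpace Ω] {P : Measure Ω} [IsProbabilityMeasure P]
  {X : (v : Node N) → Ω → Fin 2 → Fin (M v.1)}

/-- With $x=2^{-k}R$ the density is at most $\min(1,12x)\le12x^t$, where $0\le t\le1$. This is where
dimension below one matters. -/
theorem bandDensity_le_rpow (hM : ∀ n, 0 < M n) {t : ℝ} (ht0 : 0 ≤ t) (ht1 : t ≤ 1)
    (p : Fin 2) (m a : ℝ) (k j : ℕ) (x : Fin 2 → ℝ) :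
    bandDensity p m a (6 / 2 ^ k) (sideLength M j) x ≤
      12 * (((2 : ℝ) ^ (-t)) ^ k * (∏ i ∈ Finset.range j, (M i : ℝ)) ^ t) := by
  have hl := sideLength_pos hM j
  set R : ℝ := ∏ i ∈ Finset.range j, (M i : ℝ) with hR
  have hlR : sideLength M j = R⁻¹ := rfl
  have hR0 : 0 < R := inv_pos.1 hl
  rw [two_rpow_neg_pow, ← Real.mul_rpow (by positivity) hR0.le]
  rcases le_total ((2 : ℝ) ^ k) R with h | h
  · refine (bandDensity_le_one p m a _ hl x).trans ?_
    have : 1 ≤ (((2 : ℝ) ^ k)⁻¹ * R) ^ t :=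
      Real.one_le_rpow (by rwa [inv_mul_eq_div, one_le_div (by positivity)]) ht0
    linarith
  · refine (bandDensity_le p m a (by positivity) hl x).trans ?_
    rw [hlR]
    have : (((2 : ℝ) ^ k)⁻¹ * R) ^ (1 : ℝ) ≤ (((2 : ℝ) ^ k)⁻¹ * R) ^ t :=
      Real.rpow_le_rpow_of_exponent_ge (by positivity)
        (by rwa [inv_mul_eq_div, div_le_one (by positivity)]) ht1
    rw [Real.rpow_one] at this
    calc _ = 12 * (((2 : ℝ) ^ k)⁻¹ * R) := by field_simp; norm_num
      _ ≤ _ := by gcongr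

theorem measure_wordMean_bandDensity_le (hM : ∀ n, 2 ≤ M n) (hN : ∀ n, 0 < N n)
    (hX : ∀ v, Measurable (X v))
    (hunif : ∀ v q, P {ω | X v ω = q} = ((M v.1 : ℝ≥0∞) ^ 2)⁻¹)
    (hindep : iIndepFun X P) {c t t' : ℝ} (hc : 0 < c) (ht' : 0 ≤ t') (ht1' : t' ≤ 1)
    (ht1 : t ≤ 1)
    (hMN : ∀ n, c * (∏ i ∈ Finset.range n, (M i : ℝ)) ^ t' ≤ ∏ i ∈ Finset.range n, (N i : ℝ))
    {k : ℕ} (hk : 0 < k) (p : Fin 2) (m a : ℝ) :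
    P {ω | 37 * ((2 : ℝ) ^ (-t)) ^ k ≤ wordMean (fun v => X v ω) k
        (bandDensity p m a (6 / 2 ^ k) (sideLength M k))} ≤
      ENNReal.ofReal (Real.exp (-(c / 36 * ((2 : ℝ) ^ (t' - t)) ^ k / k))) := by
  have hM0 : ∀ n, 0 < M n := fun n => zero_lt_two.trans_le (hM n)
  have hk' : (0 : ℝ) < k := by exact_mod_cast hk
  set τ : ℝ := (2 : ℝ) ^ (-t) with hτ
  set τ' : ℝ := (2 : ℝ) ^ (-t') with hτ'
  have hτ0 : 0 < τ := by positivity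
  have hτ0' : 0 < τ' := by positivity
  have hD : (2 : ℝ) ^ (t' - t) = τ / τ' := by
    rw [hτ, hτ', ← Real.rpow_sub (by norm_num)]
    congr 1
    ring
  -- The largest parameter that the moment bound admits: `3 * k * u * (12 * τ' ^ k) = c`.
  set u : ℝ := c / (36 * k * τ' ^ k) with hu
  have hu0 : 0 < u := by positivity
  have h1 := lintegral_exp_wordMean_le hM0 hN hX hunif hindep hk
    (G := fun j => bandDensity p m a (6 / 2 ^ k) (sideLength M j))
    (fun j x => bandDensity_nonneg _ _ _ _ _ _)
    (fun j x => by
      have := sum_bandDensity_le p m a (6 / 2 ^ k) (sideLength_pos hM0 j) (hM0 j) x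
      rw [← sideLength_succ] at this
      exact this) hu0.le (fun j _ x => by
      calc 3 * (k : ℝ) * u * bandDensity p m a (6 / 2 ^ k) (sideLength M (j + 1)) x
          ≤ 3 * k * u * (12 * (τ' ^ k * (∏ i ∈ Finset.range (j + 1), (M i : ℝ)) ^ t')) := by
            exact mul_le_mul_of_nonneg_left (bandDensity_le_rpow hM0 ht' ht1' p m a k (j + 1) x)
              (by positivity)
        _ = c * (∏ i ∈ Finset.range (j + 1), (M i : ℝ)) ^ t' := by
            rw [hu]
            field_simp
            norm_num
        _ ≤ _ := hMN (j + 1))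
  refine (measure_le_of_lintegral_exp_le (measurable_wordMean hX _ (measurable_bandDensity _ _ _ _ _))
    hu0.le h1).trans (ENNReal.ofReal_le_ofReal (Real.exp_le_exp.2 ?_))
  have h2 : bandDensity p m a (6 / 2 ^ k) (sideLength M 0) 0 ≤ 12 * τ ^ k := by
    refine (bandDensity_le p m a (by positivity) (sideLength_pos hM0 0) 0).trans ?_
    have : ((2 : ℝ) ^ k)⁻¹ ≤ τ ^ k := by
      rw [hτ, two_rpow_neg_pow]
      conv_lhs => rw [← Real.rpow_one ((2 : ℝ) ^ k)⁻¹]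
      exact Real.rpow_le_rpow_of_exponent_ge (by positivity)
        (inv_le_one_of_one_le₀ (one_le_pow₀ (by norm_num))) ht1
    calc _ = 12 * ((2 : ℝ) ^ k)⁻¹ := by rw [sideLength_zero]; field_simp; norm_num
      _ ≤ _ := by gcongr
  have h3 : u * τ ^ k = c / 36 * ((2 : ℝ) ^ (t' - t)) ^ k / k := by
    rw [hu, hD, div_pow]
    field_simp
  -- The moment costs $3\cdot12=36$ times `u * τ ^ k` and the threshold gains 37 times it, leaving
  -- `-(u * τ ^ k)`.
  have h4 := mul_le_mul_of_nonneg_left h2 hu0.le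
  rw [← h3]
  nlinarith

/-- Choose $J$ with $D^J>2b$; then $e^x\ge x^J/J!$ bounds the terms by a multiple of $k^J2^{-k}$. -/
theorem summable_pow_mul_exp_neg {b c D : ℝ} (hc : 0 < c) (hD : 1 < D) (hb : 0 ≤ b) :
    Summable fun k : ℕ => b ^ k * Real.exp (-(c * D ^ k / k)) := by
  obtain ⟨J, hJ⟩ := pow_unbounded_of_one_lt (2 * b) hD
  have hD0 : 0 < D := zero_lt_one.trans hD
  refine Summable.of_nonneg_of_le (fun k => by positivity) (fun k => ?_)
    ((summable_pow_mul_geometric_of_norm_lt_one J (r := (1 / 2 : ℝ)) (by norm_num)).mul_left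
      (J.factorial / c ^ J : ℝ) |>.add (summable_of_ne_finset_zero (s := {0})
        (f := fun k : ℕ => if k = 0 then (1 : ℝ) else 0) (by simp)))
  -- At `k = 0` the quotient is 0 by convention, so the term is 1; the function supported at 0
  -- absorbs it.
  rcases Nat.eq_zero_or_pos k with rfl | hk
  · simp only [pow_zero, Nat.cast_zero, div_zero, neg_zero, Real.exp_zero, if_true, mul_one]
    have : 0 ≤ (J.factorial : ℝ) / c ^ J * 0 ^ J := by positivity
    linarith
  have hk' : (0 : ℝ) < k := by exact_mod_cast hk
  have h1 := Real.pow_div_factorial_le_exp (c * D ^ k / k) (by positivity) J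
  rw [if_neg hk.ne', add_zero, Real.exp_neg]
  calc b ^ k * (Real.exp (c * D ^ k / k))⁻¹ ≤ (D ^ J / 2) ^ k * ((c * D ^ k / k) ^ J / J.factorial)⁻¹ := by
        gcongr
        linarith
    _ = _ := by
        rw [div_pow (D ^ J), div_pow (c * D ^ k), mul_pow, ← pow_mul, ← pow_mul, mul_comm J k, one_div,
          inv_pow]
        field_simp

theorem ae_eventually_wordMean_bandDensity_lt (hM : ∀ n, 2 ≤ M n) (hN : ∀ n, 0 < N n)
    (hX : ∀ v, Measurable (X v))
    (hunif : ∀ v q, P {ω | X v ω = q} = ((M v.1 : ℝ≥0∞) ^ 2)⁻¹)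
    (hindep : iIndepFun X P) {c t t' : ℝ} (hc : 0 < c) (ht' : 0 ≤ t') (ht1' : t' ≤ 1)
    (htt : t < t')
    (hMN : ∀ n, c * (∏ i ∈ Finset.range n, (M i : ℝ)) ^ t' ≤ ∏ i ∈ Finset.range n, (N i : ℝ)) :
    ∀ᵐ ω ∂P, ∀ᶠ k : ℕ in atTop, ∀ p : Fin 2, ∀ i ∈ Finset.Icc (-2 ^ k : ℤ) (2 ^ k),
      ∀ j ∈ Finset.Icc (-2 ^ (k + 3) : ℤ) (2 ^ (k + 3)),
        wordMean (fun v => X v ω) k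
          (bandDensity p (i / 2 ^ k) (j / 2 ^ k) (6 / 2 ^ k) (sideLength M k)) <
            37 * ((2 : ℝ) ^ (-t)) ^ k := by
  let I (k : ℕ) : Finset (Fin 2 × ℤ × ℤ) := Finset.univ ×ˢ Finset.Icc (-2 ^ k : ℤ) (2 ^ k) ×ˢ
    Finset.Icc (-2 ^ (k + 3) : ℤ) (2 ^ (k + 3))
  let E (k : ℕ) (q : Fin 2 × ℤ × ℤ) : Set Ω :=
    {ω | 37 * ((2 : ℝ) ^ (-t)) ^ k ≤ wordMean (fun v => X v ω) k
        (bandDensity q.1 (q.2.1 / 2 ^ k) (q.2.2 / 2 ^ k) (6 / 2 ^ k) (sideLength M k))}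
  let e (k : ℕ) : ℝ := Real.exp (-(c / 36 * ((2 : ℝ) ^ (t' - t)) ^ k / k))
  have hcard : ∀ k, ((I k).card : ℝ) ≤ 102 * 4 ^ k := fun k => by
    have h2 : (1 : ℝ) ≤ 2 ^ k := one_le_pow₀ (by norm_num)
    have h1 : ((I k).card : ℤ) = 2 * ((2 * 2 ^ k + 1) * (2 * 2 ^ (k + 3) + 1)) := by
      simp only [I, Finset.card_product, Finset.card_univ, Fintype.card_fin, Int.card_Icc]
      push_cast
      have h4 : (0 : ℤ) < 2 ^ k := by positivity
      have h5 : (0 : ℤ) < 2 ^ (k + 3) := by positivity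
      rw [Int.toNat_of_nonneg (by linarith), Int.toNat_of_nonneg (by linarith)]
      ring
    have h3 : ((I k).card : ℝ) = 2 * ((2 * 2 ^ k + 1) * (2 * 2 ^ (k + 3) + 1)) := by exact_mod_cast h1
    rw [h3, show (4 : ℝ) ^ k = 2 ^ k * 2 ^ k by rw [← mul_pow]; norm_num, pow_add]
    nlinarith
  -- The shift to `k + 1` avoids level 0, where the tail bound is not available.
  have hsum : ∑' k, P (⋃ q ∈ I (k + 1), E (k + 1) q) ≠ ⊤ := by
    have hs : Summable fun k : ℕ => 102 * (4 ^ (k + 1) * e (k + 1)) :=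
      ((summable_nat_add_iff 1).2 (summable_pow_mul_exp_neg (b := 4) (c := c / 36)
        (D := (2 : ℝ) ^ (t' - t)) (by positivity)
        (Real.one_lt_rpow (by norm_num) (by linarith)) (by norm_num))).mul_left 102
    refine ne_top_of_le_ne_top hs.tsum_ofReal_ne_top (ENNReal.tsum_le_tsum fun k => ?_)
    calc P (⋃ q ∈ I (k + 1), E (k + 1) q) ≤ ∑ q ∈ I (k + 1), P (E (k + 1) q) :=
          measure_biUnion_finset_le _ _
      _ ≤ ∑ q ∈ I (k + 1), ENNReal.ofReal (e (k + 1)) := by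
          refine Finset.sum_le_sum fun q _ => ?_
          exact measure_wordMean_bandDensity_le hM hN hX hunif hindep hc ht' ht1'
            (htt.le.trans ht1') hMN k.succ_pos q.1 _ _
      _ = ENNReal.ofReal ((I (k + 1)).card * e (k + 1)) := by
          rw [Finset.sum_const, nsmul_eq_mul, ENNReal.ofReal_mul (Nat.cast_nonneg _),
            ENNReal.ofReal_natCast]
      _ ≤ _ := by
          refine ENNReal.ofReal_le_ofReal ?_
          rw [← mul_assoc]
          exact mul_le_mul_of_nonneg_right (hcard _) (Real.exp_pos _).le
  filter_upwards [ae_eventually_notMem hsum] with ω hω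
  rw [← map_add_atTop_eq_nat 1, eventually_map]
  filter_upwards [hω] with k hk p i hi j hj
  by_contra! h
  refine hk (Set.mem_biUnion (x := ((p, i, j) : Fin 2 × ℤ × ℤ)) ?_ h)
  exact Finset.mem_coe.2 (Finset.mem_product.2 ⟨Finset.mem_univ _, Finset.mem_product.2 ⟨hi, hj⟩⟩)

end Tail

/-! ### The natural measure on branches and its points. -/

/-- The label of level `n` on the infinite branch `σ`. -/
def branch {N : ℕ → ℕ} (σ : (i : ℕ) → Fin (N i)) (n : ℕ) : Word N n := fun i => σ i

/-- The uniform distribution on infinite branches. -/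
def branchMeasure (N : ℕ → ℕ) [∀ i, NeZero (N i)] : Measure ((i : ℕ) → Fin (N i)) :=
  Measure.infinitePi fun i => (PMF.uniformOfFintype (Fin (N i))).toMeasure

instance (N : ℕ → ℕ) [∀ i, NeZero (N i)] : IsProbabilityMeasure (branchMeasure N) := by
  unfold branchMeasure; infer_instance

theorem branchMeasure_branch_eq (N : ℕ → ℕ) [∀ i, NeZero (N i)] (n : ℕ) (w : Word N n) :
    branchMeasure N {σ | branch σ n = w} =
      ENNReal.ofReal (∏ i ∈ Finset.range n, (N i : ℝ))⁻¹ := by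
  have e : {σ : (i : ℕ) → Fin (N i) | branch σ n = w} = (Finset.range n : Set ℕ).pi
      fun i => if h : i < n then ({w ⟨i, h⟩} : Set (Fin (N i))) else Set.univ := by
    ext σ
    simp only [Set.mem_ofPred_eq, Set.mem_pi, Finset.coe_range, Set.mem_Iio]
    constructor
    · rintro rfl i hi
      rw [dif_pos hi]
      rfl
    · intro h
      funext i
      have := h i i.2
      rw [dif_pos i.2] at this
      exact this
  rw [e, branchMeasure, Measure.infinitePi_pi _ fun i _ => MeasurableSet.of_discrete,
    ← Finset.prod_inv_distrib, ENNReal.ofReal_prod_of_nonneg fun i _ => by positivity]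
  refine Finset.prod_congr rfl fun i hi => ?_
  have hpos : (0 : ℝ) < N i := by exact_mod_cast Nat.pos_of_ne_zero (NeZero.ne (N i))
  rw [dif_pos (Finset.mem_range.1 hi), PMF.toMeasure_apply_singleton _ _ (measurableSet_singleton _),
    PMF.uniformOfFintype_apply, Fintype.card_fin, ENNReal.ofReal_inv_of_pos hpos,
    ENNReal.ofReal_natCast]

/-- All cylinders of level `n` have equal mass, so `A` weighs at most the proportion of labels with
`f = 1`, which the mean of `f` dominates. -/
theorem branchMeasure_le_wordMean {M N : ℕ → ℕ} [∀ i, NeZero (N i)] (c : Choices M N) (n : ℕ)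
    {f : (Fin 2 → ℝ) → ℝ} (hf : ∀ x, 0 ≤ f x) {A : Set ((i : ℕ) → Fin (N i))}
    (hA : ∀ σ ∈ A, f (corner c n (branch σ n)) = 1) :
    branchMeasure N A ≤ ENNReal.ofReal (wordMean c n f) := by
  classical
  set p : ℝ := (∏ i ∈ Finset.range n, (N i : ℝ))⁻¹ with hp
  have hp0 : 0 ≤ p := by positivity
  let W : Finset (Word N n) := Finset.univ.filter fun w => f (corner c n w) = 1
  calc branchMeasure N A ≤ branchMeasure N (⋃ w ∈ W, {σ | branch σ n = w}) := by
        refine measure_mono fun σ hσ => ?_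
        exact Set.mem_biUnion (x := branch σ n) (by simp [W, hA σ hσ]) rfl
    _ ≤ ∑ w ∈ W, branchMeasure N {σ | branch σ n = w} := measure_biUnion_finset_le _ _
    _ = ∑ w ∈ W, ENNReal.ofReal (p * f (corner c n w)) := by
        refine Finset.sum_congr rfl fun w hw => ?_
        rw [branchMeasure_branch_eq, (Finset.mem_filter.1 hw).2, mul_one]
    _ ≤ ∑ w, ENNReal.ofReal (p * f (corner c n w)) :=
        Finset.sum_le_sum_of_subset (Finset.subset_univ _)
    _ = _ := by
        rw [← ENNReal.ofReal_sum_of_nonneg fun w _ => mul_nonneg hp0 (hf _), ← Finset.mul_sum,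
          wordMean]

/-- The point of the limit set on the branch `σ`. -/
def branchPoint {M N : ℕ → ℕ} (c : Choices M N) (σ : (i : ℕ) → Fin (N i)) : Plane :=
  WithLp.toLp 2 fun p => ⨆ n, corner c n (branch σ n) p

theorem corner_branch_mono {M N : ℕ → ℕ} (hM : ∀ n, 0 < M n) (c : Choices M N)
    (σ : (i : ℕ) → Fin (N i)) (p : Fin 2) : Monotone fun n => corner c n (branch σ n) p := by
  refine monotone_nat_of_le_succ fun n => ?_
  have : 0 ≤ sideLength M (n + 1) * ((c ⟨n, branch σ (n + 1)⟩ p : ℕ) : ℝ) :=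
    mul_nonneg (sideLength_pos hM _).le (Nat.cast_nonneg _)
  simp only [corner]
  exact le_add_of_nonneg_right this

theorem corner_branch_add_antitone {M N : ℕ → ℕ} (hM : ∀ n, 0 < M n) (c : Choices M N)
    (σ : (i : ℕ) → Fin (N i)) (p : Fin 2) :
    Antitone fun n => corner c n (branch σ n) p + sideLength M n := by
  refine antitone_nat_of_succ_le fun n => ?_
  have h1 : ((c ⟨n, branch σ (n + 1)⟩ p : ℕ) : ℝ) + 1 ≤ M n := by
    exact_mod_cast (c ⟨n, branch σ (n + 1)⟩ p).2
  have h2 : sideLength M (n + 1) * M n = sideLength M n := by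
    rw [sideLength_succ, div_mul_cancel₀ _ (by exact_mod_cast (hM n).ne')]
  have h3 := mul_le_mul_of_nonneg_left h1 (sideLength_pos hM (n + 1)).le
  have h4 : corner c n (Fin.init (branch σ (n + 1))) p = corner c n (branch σ n) p := rfl
  simp only [corner]
  linarith

theorem corner_branch_le_add {M N : ℕ → ℕ} (hM : ∀ n, 0 < M n) (c : Choices M N)
    (σ : (i : ℕ) → Fin (N i)) (p : Fin 2) (m n : ℕ) :
    corner c m (branch σ m) p ≤ corner c n (branch σ n) p + sideLength M n := by
  have h1 := corner_branch_mono hM c σ p (le_max_left m n)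
  have h2 := corner_branch_add_antitone hM c σ p (le_max_right m n)
  have h3 := sideLength_pos hM (max m n)
  simp only at h1 h2
  linarith

theorem branchPoint_mem_square {M N : ℕ → ℕ} (hM : ∀ n, 0 < M n) (c : Choices M N)
    (σ : (i : ℕ) → Fin (N i)) (n : ℕ) : branchPoint c σ ∈ square c n (branch σ n) := fun p =>
  ⟨le_ciSup (f := fun m => corner c m (branch σ m) p)
    ⟨_, Set.forall_mem_range.2 fun m => corner_branch_le_add hM c σ p m n⟩ n,
    ciSup_le fun m => corner_branch_le_add hM c σ p m n⟩

theorem branchPoint_mem_limitSet {M N : ℕ → ℕ} (hM : ∀ n, 0 < M n) (c : Choices M N)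
    (σ : (i : ℕ) → Fin (N i)) : branchPoint c σ ∈ limitSet c :=
  Set.mem_iInter.2 fun n => Set.mem_iUnion.2 ⟨_, branchPoint_mem_square hM c σ n⟩

theorem measurable_branchPoint {M N : ℕ → ℕ} (c : Choices M N) : Measurable (branchPoint c) := by
  refine (WithLp.measurable_toLp 2 _).comp (measurable_pi_lambda _ fun p => Measurable.iSup fun n => ?_)
  have h : Measurable fun σ : (i : ℕ) → Fin (N i) => branch σ n :=
    measurable_pi_lambda _ fun i => measurable_pi_apply _
  exact (Measurable.of_discrete (f := fun w : Word N n => corner c n w p)).comp h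

/-! ### From the net to all strips. -/

/-- The bounds on the masses of the bands of a net of width comparable to `2 ^ (-k)`. -/
def NetBound {M N : ℕ → ℕ} (c : Choices M N) (t : ℝ) (k : ℕ) : Prop :=
  ∀ p : Fin 2, ∀ i ∈ Finset.Icc (-2 ^ k : ℤ) (2 ^ k),
    ∀ j ∈ Finset.Icc (-2 ^ (k + 3) : ℤ) (2 ^ (k + 3)),
      wordMean c k (bandDensity p (i / 2 ^ k) (j / 2 ^ k) (6 / 2 ^ k) (sideLength M k)) <
        37 * ((2 : ℝ) ^ (-t)) ^ k

theorem sideLength_le {M : ℕ → ℕ} (hM : ∀ n, 2 ≤ M n) (k : ℕ) : sideLength M k ≤ 1 / 2 ^ k := by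
  rw [sideLength, one_div]
  exact inv_anti₀ (by positivity) (two_pow_le_prod hM k)

theorem abs_floor_div_sub_le (x : ℝ) (k : ℕ) : |x - (⌊x * 2 ^ k⌋ : ℝ) / 2 ^ k| ≤ 1 / 2 ^ k := by
  have h2 : (0 : ℝ) < 2 ^ k := by positivity
  have h1 := Int.floor_le (x * 2 ^ k)
  have h3 := Int.lt_floor_add_one (x * 2 ^ k)
  have e : x - (⌊x * 2 ^ k⌋ : ℝ) / 2 ^ k = (x * 2 ^ k - ⌊x * 2 ^ k⌋) / 2 ^ k := by field_simp
  rw [e, abs_div, abs_of_pos h2]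
  gcongr
  rw [abs_le]
  constructor <;> linarith

theorem floor_mem_Icc {x : ℝ} {k r : ℕ} (hx : |x| ≤ 2 ^ r) :
    ⌊x * 2 ^ k⌋ ∈ Finset.Icc (-2 ^ (k + r) : ℤ) (2 ^ (k + r)) := by
  have h2 : (0 : ℝ) < 2 ^ k := by positivity
  obtain ⟨h1, h3⟩ := abs_le.1 hx
  rw [Finset.mem_Icc, Int.le_floor, pow_add]
  constructor
  · push_cast
    nlinarith
  · have : (⌊x * 2 ^ k⌋ : ℝ) ≤ 2 ^ k * 2 ^ r := (Int.floor_le _).trans (by nlinarith)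
    exact_mod_cast this

/-- Round slope and intercept down to the net: the cell of level `k` of any branch in the thin band
lies wholly in the wider net band, so its density is 1. -/
theorem branchMeasure_abs_sub_le {M N : ℕ → ℕ} [∀ i, NeZero (N i)] (hM : ∀ n, 2 ≤ M n)
    {c : Choices M N} {t : ℝ} {k : ℕ} (hc : NetBound c t k) (p : Fin 2) {m a : ℝ} (hm : |m| ≤ 1) :
    branchMeasure N {σ | |branchPoint c σ p - m * branchPoint c σ (1 - p) - a| ≤ 2 / 2 ^ k} ≤
      ENNReal.ofReal (37 * ((2 : ℝ) ^ (-t)) ^ k) := by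
  have hM0 : ∀ n, 0 < M n := fun n => zero_lt_two.trans_le (hM n)
  have hunit : ∀ σ q, 0 ≤ branchPoint c σ q ∧ branchPoint c σ q ≤ 1 := fun σ q => by
    have := branchPoint_mem_square hM0 c σ 0 q
    simpa [corner, sideLength_zero] using this
  have h2k : (0 : ℝ) < 2 ^ k := by positivity
  have hk1 : (1 : ℝ) / 2 ^ k ≤ 1 := by
    rw [div_le_one h2k]
    exact one_le_pow₀ (by norm_num)
  have h2div : (2 : ℝ) / 2 ^ k = 2 * (1 / 2 ^ k) := by ring
  have h6div : (6 : ℝ) / 2 ^ k = 6 * (1 / 2 ^ k) := by ring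
  rcases Set.eq_empty_or_nonempty
    {σ | |branchPoint c σ p - m * branchPoint c σ (1 - p) - a| ≤ 2 / 2 ^ k} with h | ⟨σ₀, h₀⟩
  · rw [h, measure_empty]
    exact zero_le
  have hmul : ∀ m' z : ℝ, |m'| ≤ 1 → 0 ≤ z → |m' * z| ≤ z := fun m' z hm' hz => by
    rw [abs_mul, abs_of_nonneg hz]
    exact mul_le_of_le_one_left hz hm'
  -- A band containing a point of the unit square has $|a|\le2+1+1$, hence the range `2 ^ (k + 3)`
  -- for intercepts.
  have ha : |a| ≤ 2 ^ 3 := by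
    have h1 := hunit σ₀ p
    have h2 := hunit σ₀ (1 - p)
    have h3 := abs_le.1 (hmul m _ hm h2.1)
    have h4 := abs_le.1 (show |branchPoint c σ₀ p - m * branchPoint c σ₀ (1 - p) - a| ≤ 2 / 2 ^ k from h₀)
    rw [abs_le]
    constructor <;> linarith
  have hi := floor_mem_Icc (k := k) (r := 0) (by simpa using hm)
  set i := ⌊m * 2 ^ k⌋
  have hj := floor_mem_Icc (k := k) ha
  set j := ⌊a * 2 ^ k⌋
  have him := abs_floor_div_sub_le m k
  have hja := abs_floor_div_sub_le a k
  have hi1 : |(i : ℝ) / 2 ^ k| ≤ 1 := by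
    rw [abs_div, abs_of_pos h2k, div_le_one h2k]
    have := Finset.mem_Icc.1 hi
    rw [abs_le]
    exact ⟨by exact_mod_cast this.1, by exact_mod_cast this.2⟩
  refine (branchMeasure_le_wordMean c k (bandDensity_nonneg p _ _ _ _) fun σ hσ => ?_).trans
    (ENNReal.ofReal_le_ofReal (hc p i hi j hj).le)
  refine bandDensity_eq_one p (sideLength_pos hM0 k) fun z hz => ?_
  have hside := sideLength_le hM k
  have hsq := branchPoint_mem_square hM0 c σ k
  have d1 : |z.1 - branchPoint c σ p| ≤ 1 / 2 ^ k := by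
    have h1 := hsq p
    have h2 := hz.1
    rw [abs_le]
    constructor <;> linarith [h1.1, h1.2, h2.1, h2.2]
  have d2 : |z.2 - branchPoint c σ (1 - p)| ≤ 1 / 2 ^ k := by
    have h1 := hsq (1 - p)
    have h2 := hz.2
    rw [abs_le]
    constructor <;> linarith [h1.1, h1.2, h2.1, h2.2]
  have d3 : |(i : ℝ) / 2 ^ k * (z.2 - branchPoint c σ (1 - p))| ≤ 1 / 2 ^ k := by
    rw [abs_mul]
    exact (mul_le_of_le_one_left (abs_nonneg _) hi1).trans d2
  have d4 : |(m - (i : ℝ) / 2 ^ k) * branchPoint c σ (1 - p)| ≤ 1 / 2 ^ k := by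
    have := hunit σ (1 - p)
    rw [abs_mul, abs_of_nonneg this.1]
    exact (mul_le_of_le_one_right (abs_nonneg _) this.2).trans him
  have d5 : |branchPoint c σ p - m * branchPoint c σ (1 - p) - a| ≤ 2 / 2 ^ k := hσ
  -- The width adds up as $6=1+1+1+2+1$, from `d1`, `d3`, `d4`, `d5` and `hja`.
  change |z.1 - (i : ℝ) / 2 ^ k * z.2 - (j : ℝ) / 2 ^ k| ≤ 6 / 2 ^ k
  rw [h2div] at d5
  rw [h6div]
  rw [abs_le] at *
  constructor <;> nlinarith

theorem exists_coordinate_dominates {e : Plane} (he : ‖e‖ = 1) :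
    ∃ p, |e (1 - p)| ≤ |e p| ∧ 1 / 2 ≤ |e p| := by
  have h : |e 0| ^ 2 + |e 1| ^ 2 = 1 := by
    have := EuclideanSpace.norm_sq_eq e
    rw [he, Fin.sum_univ_two, Real.norm_eq_abs, Real.norm_eq_abs] at this
    linarith
  have h0 := abs_nonneg (e 0)
  have h1 := abs_nonneg (e 1)
  rcases le_total |e 1| |e 0| with h' | h'
  · exact ⟨0, by simpa using h', by nlinarith⟩
  · exact ⟨1, by simpa using h', by nlinarith⟩

/-- Dividing by the dominant coordinate of `e` makes the strip a band of slope at most 1 in absolute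
value; that coordinate being at least 1/2, the width at most doubles. -/
theorem branchMeasure_inner_le {M N : ℕ → ℕ} [∀ i, NeZero (N i)] (hM : ∀ n, 2 ≤ M n)
    {c : Choices M N} {t : ℝ} {k : ℕ} (hc : NetBound c t k) {e : Plane} (he : ‖e‖ = 1) (y : ℝ) :
    branchMeasure N {σ | |inner ℝ e (branchPoint c σ) - y| ≤ 1 / 2 ^ k} ≤
      ENNReal.ofReal (37 * ((2 : ℝ) ^ (-t)) ^ k) := by
  obtain ⟨p, hp1, hp2⟩ := exists_coordinate_dominates he
  have hp0 : e p ≠ 0 := fun h => by rw [h, abs_zero] at hp2; norm_num at hp2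
  have hm : |-(e (1 - p) / e p)| ≤ 1 := by
    rw [abs_neg, abs_div, div_le_one (by linarith)]
    exact hp1
  refine (measure_mono fun σ hσ => ?_).trans
    (branchMeasure_abs_sub_le hM hc p (a := y / e p) hm)
  have hin : inner ℝ e (branchPoint c σ) =
      e p * branchPoint c σ p + e (1 - p) * branchPoint c σ (1 - p) := by
    rw [PiLp.inner_apply, Fin.sum_univ_two]
    fin_cases p <;> simp [mul_comm, add_comm]
  have h1 : |inner ℝ e (branchPoint c σ) - y| ≤ 1 / 2 ^ k := hσ
  have h2 : branchPoint c σ p - -(e (1 - p) / e p) * branchPoint c σ (1 - p) - y / e p =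
      (inner ℝ e (branchPoint c σ) - y) / e p := by
    rw [hin]
    field_simp
    ring
  change |branchPoint c σ p - -(e (1 - p) / e p) * branchPoint c σ (1 - p) - y / e p| ≤ 2 / 2 ^ k
  rw [h2, abs_div, div_le_iff₀ (by linarith)]
  have h3 : (0 : ℝ) < 1 / 2 ^ k := by positivity
  have h4 : (2 : ℝ) / 2 ^ k = 2 * (1 / 2 ^ k) := by ring
  rw [h4]
  nlinarith

/-! ### Projected measures and the lower bound for the dimension. -/

/-- The orthogonal projection onto a line, as a map of the plane. -/
def lineProj (ℓ : AffineSubspace ℝ Plane) [Nonempty ℓ] (x : Plane) : Plane :=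
  EuclideanGeometry.orthogonalProjection ℓ x

theorem lipschitzWith_lineProj (ℓ : AffineSubspace ℝ Plane) [Nonempty ℓ] :
    LipschitzWith 1 (lineProj ℓ) := by
  refine LipschitzWith.of_dist_le_mul fun x y => ?_
  have h : lineProj ℓ x - lineProj ℓ y = ℓ.direction.starProjection (x - y) := by
    have h1 := (EuclideanGeometry.orthogonalProjection ℓ).toAffineMap.linearMap_vsub x y
    have h2 := congrArg (Subtype.val) h1
    simpa [lineProj] using h2.symm
  rw [NNReal.coe_one, one_mul, dist_eq_norm, dist_eq_norm, h]
  exact Submodule.norm_starProjection_apply_le _ _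

theorem inner_lineProj (ℓ : AffineSubspace ℝ Plane) [Nonempty ℓ] {e : Plane} (he : e ∈ ℓ.direction)
    (x : Plane) : inner ℝ e (lineProj ℓ x) = inner ℝ e x := by
  have h := EuclideanGeometry.vsub_orthogonalProjection_mem_direction_orthogonal ℓ x
  have h1 : inner ℝ e (x - lineProj ℓ x) = 0 := (Submodule.mem_orthogonal _ _).1 h e he
  rw [inner_sub_right] at h1
  linarith

/-- The projected natural measure. -/
def projMeasure {M N : ℕ → ℕ} [∀ i, NeZero (N i)] (c : Choices M N)
    (ℓ : AffineSubspace ℝ Plane) [Nonempty ℓ] : Measure Plane :=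
  (branchMeasure N).map fun σ => lineProj ℓ (branchPoint c σ)

theorem measurable_lineProj_branchPoint {M N : ℕ → ℕ} (c : Choices M N)
    (ℓ : AffineSubspace ℝ Plane) [Nonempty ℓ] :
    Measurable fun σ => lineProj ℓ (branchPoint c σ) :=
  (lipschitzWith_lineProj ℓ).continuous.measurable.comp (measurable_branchPoint c)

theorem one_le_projMeasure_image {M N : ℕ → ℕ} [∀ i, NeZero (N i)] (hM : ∀ n, 0 < M n)
    (c : Choices M N) (ℓ : AffineSubspace ℝ Plane) [Nonempty ℓ] :
    1 ≤ projMeasure c ℓ (lineProj ℓ '' limitSet c) := by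
  -- This inequality requires no measurability of the image set.
  refine le_trans ?_ (Measure.le_map_apply (measurable_lineProj_branchPoint c ℓ).aemeasurable _)
  have h : (fun σ : (i : ℕ) → Fin (N i) => lineProj ℓ (branchPoint c σ)) ⁻¹'
      (lineProj ℓ '' limitSet c) = Set.univ :=
    Set.eq_univ_of_forall fun σ => Set.mem_image_of_mem _ (branchPoint_mem_limitSet hM c σ)
  rw [h, measure_univ]

theorem projMeasure_closedBall_le {M N : ℕ → ℕ} [∀ i, NeZero (N i)] (hM : ∀ n, 2 ≤ M n)
    {c : Choices M N} {t : ℝ} {k : ℕ} (hc : NetBound c t k) (ℓ : AffineSubspace ℝ Plane)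
    [Nonempty ℓ] (hℓ : ℓ.direction ≠ ⊥) (y : Plane) :
    projMeasure c ℓ (Metric.closedBall y (1 / 2 ^ k)) ≤
      ENNReal.ofReal (37 * ((2 : ℝ) ^ (-t)) ^ k) := by
  obtain ⟨v, hv, hv0⟩ := Submodule.exists_mem_ne_zero_of_ne_bot hℓ
  set e : Plane := ‖v‖⁻¹ • v
  have he : ‖e‖ = 1 := norm_smul_inv_norm hv0
  have heℓ : e ∈ ℓ.direction := Submodule.smul_mem _ _ hv
  rw [projMeasure, Measure.map_apply (measurable_lineProj_branchPoint c ℓ)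
    Metric.isClosed_closedBall.measurableSet]
  refine (measure_mono fun σ hσ => ?_).trans (branchMeasure_inner_le hM hc he (inner ℝ e y))
  change |inner ℝ e (branchPoint c σ) - inner ℝ e y| ≤ 1 / 2 ^ k
  rw [← inner_lineProj ℓ heℓ, ← inner_sub_right]
  refine (abs_real_inner_le_norm _ _).trans ?_
  rw [he, one_mul, ← dist_eq_norm]
  exact hσ

theorem projMeasure_le_ediam {M N : ℕ → ℕ} [∀ i, NeZero (N i)] (hM : ∀ n, 2 ≤ M n)
    {c : Choices M N} {t : ℝ} (ht : 0 < t) {K : ℕ} (hc : ∀ k ≥ K, NetBound c t k)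
    (ℓ : AffineSubspace ℝ Plane) [Nonempty ℓ] (hℓ : ℓ.direction ≠ ⊥) {S : Set Plane}
    (hS : Metric.ediam S ≤ ENNReal.ofReal (1 / 2 ^ K)) :
    projMeasure c ℓ S ≤ ENNReal.ofReal (37 * 2 ^ t) * Metric.ediam S ^ t := by
  rcases S.eq_empty_or_nonempty with rfl | ⟨y, hy⟩
  · simp
  have htop : Metric.ediam S ≠ ⊤ := ne_top_of_le_ne_top ENNReal.ofReal_ne_top hS
  obtain ⟨r, hr0, hr⟩ : ∃ r : ℝ, 0 ≤ r ∧ Metric.ediam S = ENNReal.ofReal r :=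
    ⟨_, ENNReal.toReal_nonneg, (ENNReal.ofReal_toReal htop).symm⟩
  have hball : ∀ k ≥ K, r ≤ 1 / 2 ^ k →
      projMeasure c ℓ S ≤ ENNReal.ofReal (37 * ((2 : ℝ) ^ (-t)) ^ k) := fun k hk hrk => by
    refine (measure_mono fun z hz => ?_).trans (projMeasure_closedBall_le hM (hc k hk) ℓ hℓ y)
    have h1 := Metric.edist_le_ediam_of_mem hz hy
    rw [hr, edist_dist] at h1
    exact ((ENNReal.ofReal_le_ofReal_iff hr0).1 h1).trans hrk
  rw [hr] at hS
  have hrK : r ≤ 1 / 2 ^ K := (ENNReal.ofReal_le_ofReal_iff (by positivity)).1 hS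
  rw [hr]
  rcases hr0.eq_or_lt with h0 | h0
  -- Diameter zero: `S` lies in balls of all small dyadic radii, whose masses tend to 0.
  · have hlim : Tendsto (fun k : ℕ => ENNReal.ofReal (37 * ((2 : ℝ) ^ (-t)) ^ k)) atTop
        (nhds (ENNReal.ofReal (37 * 0))) :=
      ENNReal.tendsto_ofReal ((tendsto_pow_atTop_nhds_zero_of_lt_one (by positivity)
        (Real.rpow_lt_one_of_one_lt_of_neg (by norm_num) (by linarith))).const_mul _)
    have h1 := ge_of_tendsto hlim (eventually_atTop.2 ⟨K, fun k hk => hball k hk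
      (by rw [← h0]; positivity)⟩)
    rw [mul_zero, ENNReal.ofReal_zero] at h1
    exact h1.trans zero_le
  · have hK1 : (1 : ℝ) / 2 ^ K ≤ 1 := by
      rw [div_le_one (by positivity)]
      exact one_le_pow₀ (by norm_num)
    -- Dyadic scale with $2^{-(k+1)}<r\le2^{-k}$; replacing $2^{-k}$ by $2r$ gives the factor `2 ^
    -- t`.
    obtain ⟨k, hk1, hk2⟩ := exists_nat_pow_near_of_lt_one h0 (hrK.trans hK1)
      (y := (1 / 2 : ℝ)) (by norm_num) (by norm_num)
    rw [one_div_pow] at hk1 hk2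
    have hkK : K ≤ k := by
      by_contra! h
      have : (1 : ℝ) / 2 ^ K ≤ 1 / 2 ^ (k + 1) :=
        one_div_le_one_div_of_le (by positivity) (pow_le_pow_right₀ (by norm_num) h)
      linarith
    refine (hball k hkK hk2).trans ?_
    rw [ENNReal.ofReal_rpow_of_pos h0, ← ENNReal.ofReal_mul (by positivity)]
    refine ENNReal.ofReal_le_ofReal ?_
    rw [two_rpow_neg_pow, mul_assoc, ← Real.mul_rpow (by norm_num) h0.le]
    gcongr
    rw [pow_succ, one_div, mul_inv] at hk1
    linarith

/-- Mass distribution principle: the rescaled projected measure is dominated by the `t`-dimensional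
Hausdorff measure and charges the image. -/
theorem le_dimH_image_lineProj {M N : ℕ → ℕ} (hM : ∀ n, 2 ≤ M n) (hN : ∀ n, 0 < N n)
    {c : Choices M N} {t : ℝ} (ht : 0 < t) (hc : ∀ᶠ k in atTop, NetBound c t k)
    (ℓ : AffineSubspace ℝ Plane) [Nonempty ℓ] (hℓ : ℓ.direction ≠ ⊥) :
    ENNReal.ofReal t ≤ dimH (lineProj ℓ '' limitSet c) := by
  have : ∀ i, NeZero (N i) := fun i => ⟨(hN i).ne'⟩
  obtain ⟨K, hK⟩ := eventually_atTop.1 hc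
  set C : ℝ≥0∞ := ENNReal.ofReal (37 * 2 ^ t)
  have hC0 : C ≠ 0 := (ENNReal.ofReal_pos.2 (by positivity)).ne'
  have hCtop : C ≠ ⊤ := ENNReal.ofReal_ne_top
  have h1 : C⁻¹ • projMeasure c ℓ ≤ Measure.hausdorffMeasure t := by
    refine Measure.le_hausdorffMeasure t _ (ENNReal.ofReal (1 / 2 ^ K))
      (ENNReal.ofReal_pos.2 (by positivity)) fun S hS => ?_
    rw [Measure.smul_apply, smul_eq_mul, ENNReal.inv_mul_le_iff hC0 hCtop]
    exact projMeasure_le_ediam hM ht hK ℓ hℓ hS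
  refine le_dimH_of_hausdorffMeasure_ne_zero (d := t.toNNReal) ?_
  rw [Real.coe_toNNReal t ht.le]
  refine (lt_of_lt_of_le ?_ (h1 _)).ne'
  rw [Measure.smul_apply, smul_eq_mul]
  exact ENNReal.mul_pos (ENNReal.inv_ne_zero.2 hCtop) (zero_lt_one.trans_le
    (one_le_projMeasure_image (fun n => zero_lt_two.trans_le (hM n)) c ℓ)).ne'

/-! ### The upper bound by natural covers. -/

theorem ediam_square_le {M N : ℕ → ℕ} (hM : ∀ n, 0 < M n) (c : Choices M N) (n : ℕ) (w : Word N n) :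
    Metric.ediam (square c n w) ≤ ENNReal.ofReal (2 * sideLength M n) := by
  have hl := sideLength_pos hM n
  refine Metric.ediam_le fun x hx y hy => ?_
  rw [edist_dist]
  refine ENNReal.ofReal_le_ofReal ?_
  rw [EuclideanSpace.dist_eq, Fin.sum_univ_two]
  refine Real.sqrt_le_iff.2 ⟨by positivity, ?_⟩
  have h : ∀ i, dist (x i) (y i) ^ 2 ≤ sideLength M n ^ 2 := fun i => by
    refine pow_le_pow_left₀ dist_nonneg ?_ 2
    have h1 := hx i
    have h2 := hy i
    rw [Real.dist_eq, abs_le]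
    constructor <;> linarith [h1.1, h1.2, h2.1, h2.2]
  nlinarith [h 0, h 1, sq_nonneg (sideLength M n)]

/-- For the infinitely many good `n` the covering sum is at most `2 ^ d`, and the Hausdorff measure
is bounded by a liminf, which sees only these. -/
theorem dimH_limitSet_le {M N : ℕ → ℕ} (hM : ∀ n, 2 ≤ M n) {d : ℝ} (hd : 0 ≤ d)
    (h : ∃ᶠ n : ℕ in atTop, ∏ i ∈ Finset.range n, (N i : ℝ) ≤
      (∏ i ∈ Finset.range n, (M i : ℝ)) ^ d) (c : Choices M N) :
    dimH (limitSet c) ≤ ENNReal.ofReal d := by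
  have hM0 : ∀ n, 0 < M n := fun n => zero_lt_two.trans_le (hM n)
  refine dimH_le_of_hausdorffMeasure_ne_top (d := d.toNNReal) ?_
  rw [Real.coe_toNNReal d hd]
  have hlim : Tendsto (fun n => ENNReal.ofReal (2 * sideLength M n)) atTop (nhds 0) := by
    have h1 : Tendsto (sideLength M) atTop (nhds 0) := by
      refine squeeze_zero (fun n => (sideLength_pos hM0 n).le) (fun n => sideLength_le hM n) ?_
      simp_rw [← one_div_pow]
      exact tendsto_pow_atTop_nhds_zero_of_lt_one (by norm_num) (by norm_num)
    simpa using ENNReal.tendsto_ofReal (h1.const_mul 2)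
  refine ne_top_of_le_ne_top (b := ENNReal.ofReal (2 ^ d)) ENNReal.ofReal_ne_top
    ((Measure.hausdorffMeasure_le_liminf_sum d (limitSet c) _ hlim (fun n w => square c n w)
      (Eventually.of_forall fun n w => ediam_square_le hM0 c n w)
      (Eventually.of_forall fun n => Set.iInter_subset _ n)).trans
        (liminf_le_of_frequently_le' (h.mono fun n hn => ?_)))
  have hl := sideLength_pos hM0 n
  have hcard : (Fintype.card (Word N n) : ℝ) = ∏ i ∈ Finset.range n, (N i : ℝ) := by
    rw [Fintype.card_pi, ← Fin.prod_univ_eq_prod_range]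
    simp
  calc ∑ w, Metric.ediam (square c n w) ^ d
      ≤ ∑ _w : Word N n, ENNReal.ofReal ((2 * sideLength M n) ^ d) := by
        refine Finset.sum_le_sum fun w _ => ?_
        rw [← ENNReal.ofReal_rpow_of_pos (by positivity)]
        exact ENNReal.rpow_le_rpow (ediam_square_le hM0 c n w) hd
    _ = ENNReal.ofReal ((∏ i ∈ Finset.range n, (N i : ℝ)) * (2 * sideLength M n) ^ d) := by
        rw [Finset.sum_const, nsmul_eq_mul, Finset.card_univ,
          ENNReal.ofReal_mul (Finset.prod_nonneg fun _ _ => Nat.cast_nonneg _), ← hcard,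
          ENNReal.ofReal_natCast]
    _ ≤ ENNReal.ofReal (2 ^ d) := by
        refine ENNReal.ofReal_le_ofReal ?_
        have hR : (∏ i ∈ Finset.range n, (M i : ℝ)) ^ d * sideLength M n ^ d = 1 := by
          have hR0 : (0 : ℝ) < ∏ i ∈ Finset.range n, (M i : ℝ) := inv_pos.1 hl
          rw [← Real.mul_rpow hR0.le hl.le, sideLength, mul_inv_cancel₀ hR0.ne', Real.one_rpow]
        calc _ ≤ (∏ i ∈ Finset.range n, (M i : ℝ)) ^ d * (2 * sideLength M n) ^ d := by gcongr
          _ = 2 ^ d * ((∏ i ∈ Finset.range n, (M i : ℝ)) ^ d * sideLength M n ^ d) := by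
              rw [Real.mul_rpow (by norm_num) hl.le]
              ring
          _ = 2 ^ d := by rw [hR, mul_one]

/-! ### Products of the $N_i$ against powers of products of the $M_i$. -/

section Exponent

variable {M N : ℕ → ℕ}

/-- The exponent `d` for which `N 0 * ⋯ * N (n - 1) = (M 0 * ⋯ * M (n - 1)) ^ d`. -/
def exponent (M N : ℕ → ℕ) (n : ℕ) : ℝ :=
  (∑ i ∈ Finset.range n, Real.log (N i)) / (∑ i ∈ Finset.range n, Real.log (M i))

theorem prod_eq_rpow_exponent (hM : ∀ n, 2 ≤ M n) (hN : ∀ n, 0 < N n) {n : ℕ} (hn : 0 < n) :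
    ∏ i ∈ Finset.range n, (N i : ℝ) = (∏ i ∈ Finset.range n, (M i : ℝ)) ^ exponent M N n := by
  have hM' : ∀ i, (0 : ℝ) < M i := fun i => by exact_mod_cast zero_lt_two.trans_le (hM i)
  have hN' : ∀ i, (0 : ℝ) < N i := fun i => by exact_mod_cast hN i
  have h1 : (1 : ℝ) < ∏ i ∈ Finset.range n, (M i : ℝ) :=
    (one_lt_pow₀ (by norm_num) hn.ne').trans_le (two_pow_le_prod hM n)
  rw [exponent, ← Real.log_prod fun i _ => (hN' i).ne', ← Real.log_prod fun i _ => (hM' i).ne',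
    Real.rpow_def_of_pos (by linarith), mul_div_cancel₀ _ (Real.log_pos h1).ne',
    Real.exp_log (Finset.prod_pos fun i _ => hN' i)]

theorem exponent_nonneg (hM : ∀ n, 2 ≤ M n) (hN : ∀ n, 0 < N n) (n : ℕ) : 0 ≤ exponent M N n :=
  div_nonneg
    (Finset.sum_nonneg fun i _ => Real.log_nonneg (by exact_mod_cast hN i))
    (Finset.sum_nonneg fun i _ => Real.log_nonneg (by exact_mod_cast one_le_two.trans (hM i)))

theorem exponent_le_two (hM : ∀ n, 2 ≤ M n) (hN : ∀ n, 0 < N n) (hNM : ∀ n, N n ≤ M n ^ 2)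
    (n : ℕ) : exponent M N n ≤ 2 := by
  refine div_le_of_le_mul₀
    (Finset.sum_nonneg fun i _ => Real.log_nonneg (by exact_mod_cast one_le_two.trans (hM i)))
    (by norm_num) ?_
  rw [Finset.mul_sum]
  refine Finset.sum_le_sum fun i _ => ?_
  have h := Real.log_le_log (x := (N i : ℝ)) (y := (M i : ℝ) ^ 2) (by exact_mod_cast hN i)
    (by exact_mod_cast hNM i)
  rw [Real.log_pow] at h
  exact_mod_cast h

theorem one_le_prod_range (hM : ∀ n, 2 ≤ M n) (n : ℕ) :
    (1 : ℝ) ≤ ∏ i ∈ Finset.range n, (M i : ℝ) :=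
  (one_le_pow₀ (by norm_num)).trans (two_pow_le_prod hM n)

theorem frequently_prod_le_rpow (hM : ∀ n, 2 ≤ M n) (hN : ∀ n, 0 < N n)
    (hNM : ∀ n, N n ≤ M n ^ 2) {d : ℝ} (hd : liminf (exponent M N) atTop < d) :
    ∃ᶠ n : ℕ in atTop, ∏ i ∈ Finset.range n, (N i : ℝ) ≤ (∏ i ∈ Finset.range n, (M i : ℝ)) ^ d := by
  have h := frequently_lt_of_liminf_lt
    (isBoundedUnder_of ⟨2, exponent_le_two hM hN hNM⟩ :
      IsBoundedUnder (· ≤ ·) atTop (exponent M N)).isCoboundedUnder_ge hd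
  refine (h.and_eventually (eventually_gt_atTop 0)).mono fun n hn => ?_
  rw [prod_eq_rpow_exponent hM hN hn.2]
  exact Real.rpow_le_rpow_of_exponent_le (one_le_prod_range hM n) hn.1.le

/-- Beyond some `n₀` the bound holds with constant 1; the constant only absorbs the finitely many
smaller `n`, where the product of the $N_i$ is at least 1. -/
theorem exists_mul_rpow_le_prod (hM : ∀ n, 2 ≤ M n) (hN : ∀ n, 0 < N n) {t : ℝ} (ht0 : 0 ≤ t)
    (ht : t < liminf (exponent M N) atTop) :
    ∃ c > 0, ∀ n, c * (∏ i ∈ Finset.range n, (M i : ℝ)) ^ t ≤ ∏ i ∈ Finset.range n, (N i : ℝ) := by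
  have h := eventually_lt_of_lt_liminf ht (isBoundedUnder_of ⟨0, exponent_nonneg hM hN⟩)
  obtain ⟨n₀, hn₀⟩ := eventually_atTop.1 (h.and (eventually_gt_atTop 0))
  have hR := one_le_prod_range hM
  have hR0 : ∀ n, (0 : ℝ) < ∏ i ∈ Finset.range n, (M i : ℝ) := fun n => zero_lt_one.trans_le (hR n)
  refine ⟨((∏ i ∈ Finset.range n₀, (M i : ℝ)) ^ t)⁻¹,
    inv_pos.2 (Real.rpow_pos_of_pos (hR0 n₀) t), fun n => ?_⟩
  have h1 := Real.one_le_rpow (hR n₀) ht0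
  rw [inv_mul_le_iff₀ (by linarith)]
  rcases le_total n₀ n with hn | hn
  · have h2 : (∏ i ∈ Finset.range n, (M i : ℝ)) ^ t ≤ ∏ i ∈ Finset.range n, (N i : ℝ) := by
      rw [prod_eq_rpow_exponent hM hN (hn₀ n hn).2]
      exact Real.rpow_le_rpow_of_exponent_le (hR n) (hn₀ n hn).1.le
    exact h2.trans (le_mul_of_one_le_left ((Real.rpow_pos_of_pos (hR0 n) t).le.trans h2) h1)
  · have h3 : (1 : ℝ) ≤ ∏ i ∈ Finset.range n, (N i : ℝ) :=
      Finset.one_le_prod fun i _ => by exact_mod_cast hN i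
    refine le_trans ?_ (le_mul_of_one_le_right (by linarith) h3)
    refine Real.rpow_le_rpow (hR0 n).le ?_ ht0
    exact Finset.prod_le_prod_of_subset_of_one_le (Finset.range_subset_range.2 hn)
      (fun i _ => Nat.cast_nonneg _) fun i _ _ => by exact_mod_cast one_le_two.trans (hM i)

end Exponent

end RandomCantor

end

/-! ### Conclusion. -/

theorem theorem2p1 (M N : ℕ → ℕ) (hM : ∀ n, 2 ≤ M n) (hN : ∀ n, 1 ≤ N n)
    (hNM : ∀ n, N n ≤ M n ^ 2) (s : ℝ)
    (hs : s = liminf (fun n : ℕ => (∑ i ∈ Finset.range n, Real.log (N i)) /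
      (∑ i ∈ Finset.range n, Real.log (M i))) atTop)
    (hs1 : s < 1)
    {Ω : Type*} [MeasurableSpace Ω] (P : Measure Ω) [IsProbabilityMeasure P]
    (X : (v : RandomCantor.Node N) → Ω → Fin 2 → Fin (M v.1))
    (hX : ∀ v, Measurable (X v))
    (hunif : ∀ v q, P {ω | X v ω = q} = ((M v.1 : ℝ≥0∞) ^ 2)⁻¹)
    (hindep : iIndepFun X P) :
    ∀ᵐ ω ∂P, ∀ (ℓ : AffineSubspace ℝ RandomCantor.Plane) [Nonempty ℓ],
      Module.finrank ℝ ℓ.direction = 1 →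
        dimH ((fun x => (EuclideanGeometry.orthogonalProjection ℓ x : RandomCantor.Plane)) ''
          RandomCantor.limitSet (fun v => X v ω)) = ENNReal.ofReal s := by
  have hs' : s = liminf (RandomCantor.exponent M N) atTop := hs
  have hlower : ∀ t, 0 < t → t < s → ∀ᵐ ω ∂P, ∀ᶠ k in atTop,
      RandomCantor.NetBound (fun v => X v ω) t k := fun t ht0 hts => by
    -- The auxiliary exponent is the midpoint of `t` and `s`, still below 1.
    obtain ⟨c, hc, hMN⟩ := RandomCantor.exists_mul_rpow_le_prod (t := (t + s) / 2) hM hN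
      (by linarith) (by linarith)
    exact RandomCantor.ae_eventually_wordMean_bandDensity_lt hM hN hX hunif hindep hc
      (by linarith) (by linarith) (by linarith) hMN
  -- Countably many positive exponents increasing to `s` give one almost sure event. It does not
  -- mention `ℓ`, so all lines are handled at once.
  have hall : ∀ᵐ ω ∂P, ∀ n : ℕ, 0 < s → ∀ᶠ k in atTop,
      RandomCantor.NetBound (fun v => X v ω) (s - s / ((n : ℝ) + 2)) k := by
    refine ae_all_iff.2 fun n => ?_
    by_cases h : 0 < s
    · have h2 : s / ((n : ℝ) + 2) < s := div_lt_self h (by linarith [(n.cast_nonneg : (0 : ℝ) ≤ n)])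
      have h3 : 0 < s / ((n : ℝ) + 2) := by positivity
      filter_upwards [hlower _ (sub_pos.2 h2) (by linarith)] with ω hω _ using hω
    · exact Eventually.of_forall fun ω h' => absurd h' h
  filter_upwards [hall] with ω hω ℓ _ hℓ
  change dimH (RandomCantor.lineProj ℓ '' _) = _
  have hzero : Tendsto (fun n : ℕ => s / ((n : ℝ) + 2)) atTop (nhds 0) :=
    Tendsto.div_atTop tendsto_const_nhds
      (tendsto_atTop_add_const_right _ _ tendsto_natCast_atTop_atTop)
  apply le_antisymm
  · refine ((RandomCantor.lipschitzWith_lineProj ℓ).dimH_image_le _).trans ?_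
    have hlim : Tendsto (fun n : ℕ => ENNReal.ofReal (s + 1 / ((n : ℝ) + 1))) atTop
        (nhds (ENNReal.ofReal (s + 0))) :=
      ENNReal.tendsto_ofReal (tendsto_one_div_add_atTop_nhds_zero_nat.const_add s)
    rw [add_zero] at hlim
    refine ge_of_tendsto' hlim fun n => ?_
    have hpos : (0 : ℝ) < 1 / ((n : ℝ) + 1) := by positivity
    have hs0 : 0 ≤ s := by
      rw [hs']
      exact le_liminf_of_le (isBoundedUnder_of ⟨2, RandomCantor.exponent_le_two hM hN hNM⟩ :
        IsBoundedUnder (· ≤ ·) atTop (RandomCantor.exponent M N)).isCoboundedUnder_ge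
        (Eventually.of_forall (RandomCantor.exponent_nonneg hM hN))
    exact RandomCantor.dimH_limitSet_le hM (by linarith)
      (RandomCantor.frequently_prod_le_rpow hM hN hNM (by linarith)) _
  · rcases le_or_gt s 0 with h0 | h0
    · rw [ENNReal.ofReal_of_nonpos h0]
      exact zero_le
    have hdir : ℓ.direction ≠ ⊥ := fun h => by
      rw [h, finrank_bot] at hℓ
      exact zero_ne_one hℓ
    have hlim : Tendsto (fun n : ℕ => ENNReal.ofReal (s - s / ((n : ℝ) + 2))) atTop
        (nhds (ENNReal.ofReal (s - 0))) := ENNReal.tendsto_ofReal (hzero.const_sub s)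
    rw [sub_zero] at hlim
    refine le_of_tendsto' hlim fun n => ?_
    exact RandomCantor.le_dimH_image_lineProj hM hN
      (sub_pos.2 (div_lt_self h0 (by linarith [(n.cast_nonneg : (0 : ℝ) ≤ n)]))) (hω n h0) ℓ hdir
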